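/- Let $Q=\{(\chi,\tau)\in\mathbb{R}^2:\chi\ge 0,\ \tau\ge 0\}$ and $$F(\chi,\tau)=16\tau^4+(8\chi^2-72\chi+108)\tau^2+\chi^4-2\chi^3 .$$ Let $\mathcal{C}=\{(\chi,\tau)\in Q: F(\chi,\tau)<0\}$ be the bounded region enclosed by the curve $F=0$; its boundary curve has a cusp at $(\chi^\sharp,\tau^\sharp)=\left(\tfrac94,\tfrac{3\sqrt3}{8}\right)$. Let $$\begin{aligned}D(\chi,\tau)={}&-(8\tau^2-\chi^2)(100\tau^2+\chi^2)^4\\&+2\chi^8+1040\chi^6\tau^2+1741728\chi^4\tau^4-125516800\chi^2\tau^6+730880000\tau^8\\&+\chi^6+504\chi^4\tau^2+3103488\chi^2\tau^4+67627008\tau^6+1492992\tau^4,\end{aligned}$$ let $\mathcal{S}$ be the union of the bounded connected components of $\{(\chi,\tau)\in Q\setminus\overline{\mathcal{C}}: D(\chi,\tau)\ne 0\}$ (there is only one), and let $\mathcal{E}=Q\setminus\overline{\mathcal{C}\cup\mathcal{S}}$. Let $P(u;\chi,\tau)$ be the polynomial of degree seven in $u$ $$\begin{aligned}P(u;\chi,\tau)={}&81u^7-189\chi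 u^6+(162\chi^2+72\tau^2)u^5-(66\chi^2+120\tau^2)\chi u^4\\&+(13\chi^4+56\chi^2\tau^2+16\tau^4+432\tau^2)u^3-(\chi^4+8\chi^2\tau^2+16\tau^4+432\tau^2)\chi u^2\\&+144\chi^2\tau^2u-16\chi^3\tau^2 .\end{aligned}$$ For every $(\chi,\tau)\in\overline{\mathcal{E}\cup\mathcal{S}}$, the polynomial $P(u;\chi,\tau)$ has exactly one real root of odd multiplicity, denoted $u(\chi,\tau)$; moreover $u(0,\tau)=0$ for $\tau>0$ and $u(\chi,0)=\chi$ for $\chi>2$. Furthermore, there are a number $\tau_1>0$ and a set $X\subset(0,\infty)$ with at most three elements such that for every $(\chi,\tau)\in\overline{\mathcal{E}\cup\mathcal{S}}$ with $\chi\ne 0$ and $(\chi,\tau)\notin X\times\{\tau_1\}$: (i) if $\tau\neq 0$, then $u(\chi,\tau)$ is the only real root of $P(u;\chi,\tau)$; (ii) if $(\chi,\tau)\ne(\chi^\sharp,\tau^\sharp)$, then $u(\chi,\tau)$ is a simple root of $P(u;\chi,\tau)$. -/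

import Mathlib

namespace RogueWave

/-- The closed first quadrant of the `(χ, τ)`-plane. -/
def quadrant : Set (ℝ × ℝ) := {p | 0 ≤ p.1 ∧ 0 ≤ p.2}

/-- The polynomial whose zero set in the quadrant is the locus where the critical points of the
unmodified phase collide. For `τ > 0` it is negative exactly where the cubic
`2 τ l ^ 3 + χ l ^ 2 + 2 τ l + χ - 2` (in `l`) has three distinct real roots. -/
def boundaryPoly (χ τ : ℝ) : ℝ :=
  16 * τ ^ 4 + (8 * χ ^ 2 - 72 * χ + 108) * τ ^ 2 + χ ^ 4 - 2 * χ ^ 3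

/-- The bounded, relatively open region of the quadrant enclosed by the curve
`boundaryPoly χ τ = 0`. -/
def regionC : Set (ℝ × ℝ) := {p | p ∈ quadrant ∧ boundaryPoly p.1 p.2 < 0}

/-- The part of the quadrant exterior to the closure of `regionC`. -/
def exterior : Set (ℝ × ℝ) := quadrant \ closure regionC

/-- The polynomial cutting out the curves on which the quadratic factor of the derivative of the
genus-zero phase has a double root. It is the sum of four homogeneous polynomials. -/
def discPoly (χ τ : ℝ) : ℝ :=
  -(8 * τ ^ 2 - χ ^ 2) * (100 * τ ^ 2 + χ ^ 2) ^ 4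
    + (2 * χ ^ 8 + 1040 * χ ^ 6 * τ ^ 2 + 1741728 * χ ^ 4 * τ ^ 4
        - 125516800 * χ ^ 2 * τ ^ 6 + 730880000 * τ ^ 8)
    + (χ ^ 6 + 504 * χ ^ 4 * τ ^ 2 + 3103488 * χ ^ 2 * τ ^ 4 + 67627008 * τ ^ 6)
    + 1492992 * τ ^ 4

/-- The exterior region with the curves of vanishing discriminant removed. -/
def cutExterior : Set (ℝ × ℝ) := {p | p ∈ exterior ∧ discPoly p.1 p.2 ≠ 0}

/-- The bounded component of the exterior region cut along the curves of vanishing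
discriminant. -/
def regionS : Set (ℝ × ℝ) :=
  {p | p ∈ cutExterior ∧ Bornology.IsBounded (connectedComponentIn cutExterior p)}

/-- The unbounded region: the part of the quadrant exterior to the closure of
`regionC ∪ regionS`. -/
def regionE : Set (ℝ × ℝ) := quadrant \ closure (regionC ∪ regionS)

open Polynomial in
/-- The septic polynomial `P(u; χ, τ)` in the indeterminate `u`. -/
noncomputable def septic (χ τ : ℝ) : ℝ[X] :=
  C 81 * X ^ 7
    - C (189 * χ) * X ^ 6
    + C (162 * χ ^ 2 + 72 * τ ^ 2) * X ^ 5
    - C ((66 * χ ^ 2 + 120 * τ ^ 2) * χ) * X ^ 4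
    + C (13 * χ ^ 4 + 56 * χ ^ 2 * τ ^ 2 + 16 * τ ^ 4 + 432 * τ ^ 2) * X ^ 3
    - C ((χ ^ 4 + 8 * χ ^ 2 * τ ^ 2 + 16 * τ ^ 4 + 432 * τ ^ 2) * χ) * X ^ 2
    + C (144 * χ ^ 2 * τ ^ 2) * X
    - C (16 * χ ^ 3 * τ ^ 2)

/-- The non-smooth point (cusp) of the curve bounding `regionC`. -/
noncomputable def cornerPoint : ℝ × ℝ := (9 / 4, 3 * Real.sqrt 3 / 8)

end RogueWave

namespace RogueWave

open Polynomial

/-! ### The quadrant region -/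

theorem quadrant_and_boundaryPoly_nonneg {p : ℝ × ℝ} (hp : p ∈ closure (regionE ∪ regionS)) :
    0 ≤ p.1 ∧ 0 ≤ p.2 ∧ 0 ≤ boundaryPoly p.1 p.2 := by
  have hclosed : IsClosed {p : ℝ × ℝ | 0 ≤ p.1 ∧ 0 ≤ p.2 ∧ 0 ≤ boundaryPoly p.1 p.2} := by
    have hcont : Continuous fun p : ℝ × ℝ => boundaryPoly p.1 p.2 := by
      unfold boundaryPoly
      fun_prop
    exact (isClosed_le continuous_const continuous_fst).inter
      ((isClosed_le continuous_const continuous_snd).inter (isClosed_le continuous_const hcont))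
  refine closure_minimal ?_ hclosed hp
  have key : ∀ x ∈ quadrant, x ∉ regionC →
      0 ≤ x.1 ∧ 0 ≤ x.2 ∧ 0 ≤ boundaryPoly x.1 x.2 := fun x hx hC =>
    ⟨hx.1, hx.2, not_lt.1 fun h => hC ⟨hx, h⟩⟩
  rintro x (hx | hx)
  · exact key x hx.1 fun h => hx.2 (subset_closure (Or.inl h))
  · exact key x hx.1.1.1 fun h => hx.1.1.2 (subset_closure h)

/-! ### Multiplicities of real roots -/

theorem odd_rootMultiplicity_of_unique_root {p : ℝ[X]} {a x₀ x₁ : ℝ}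
    (hroot : ∀ x, p.IsRoot x → x = a) (h₀ : p.eval x₀ < 0) (h₁ : 0 < p.eval x₁) :
    Odd (p.rootMultiplicity a) := by
  have hp : p ≠ 0 := by rintro rfl; simp at h₁
  obtain ⟨q, hq, hdvd⟩ := exists_eq_pow_rootMultiplicity_mul_and_not_dvd p hp a
  have hq0 : ∀ x, q.eval x ≠ 0 := by
    intro x hx
    have hxa : x = a := hroot x (by rw [hq]; simp [IsRoot, hx])
    exact hdvd (dvd_iff_isRoot.2 (hxa ▸ hx))
  by_contra hodd
  have heven : Even (p.rootMultiplicity a) := Nat.not_odd_iff_even.1 hodd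
  have e (x : ℝ) : p.eval x = (x - a) ^ p.rootMultiplicity a * q.eval x := by
    conv_lhs => rw [hq]
    simp
  have hs₀ : q.eval x₀ < 0 := by
    by_contra h
    have := mul_nonneg (heven.pow_nonneg (x₀ - a)) (not_lt.1 h)
    rw [← e] at this
    linarith
  have hs₁ : 0 < q.eval x₁ := by
    by_contra h
    have := mul_nonpos_of_nonneg_of_nonpos (heven.pow_nonneg (x₁ - a)) (not_lt.1 h)
    rw [← e] at this
    linarith
  obtain ⟨x, hx⟩ := mem_range_of_exists_le_of_exists_ge q.continuous ⟨x₀, hs₀.le⟩ ⟨x₁, hs₁.le⟩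
  exact hq0 x hx

/-! ### The septic polynomial -/

theorem eval_septic (χ τ u : ℝ) : 27 * (septic χ τ).eval u =
    (3 * u) ^ 2 * (3 * u - 3 * χ) * ((3 * u - χ) ^ 2 + 4 * τ ^ 2) ^ 2
      + 432 * τ ^ 2 * (3 * u - χ) ^ 3 := by
  simp only [septic, eval_add, eval_sub, eval_mul, eval_pow, eval_C, eval_X]
  ring

theorem septic_zero_right (χ : ℝ) :
    septic χ 0 = (X - C χ) * (X ^ 2 * (C 3 * X - C χ) ^ 4) := by
  simp only [septic, map_add, map_mul, map_pow, map_ofNat, map_zero]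
  ring

theorem septic_ne_zero (χ τ : ℝ) : septic χ τ ≠ 0 := by
  intro h
  have h1 := congrArg (coeff · 7) h
  simp only [septic, coeff_add, coeff_sub, coeff_C_mul, coeff_X_pow, coeff_X, coeff_C,
    coeff_zero] at h1
  norm_num at h1

theorem rootMultiplicity_septic_zero_right (χ x : ℝ) :
    (septic χ 0).rootMultiplicity x =
      (if x = χ then 1 else 0) + ((if x = 0 then 2 else 0) + (if x = χ / 3 then 4 else 0)) := by
  have h3 : C 3 * X - C χ = C 3 * (X - C (χ / 3)) := by
    rw [mul_sub, ← C_mul]; congr 2; ring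
  have hX : (X : ℝ[X]) = X - C 0 := by simp
  have hne : septic χ 0 ≠ 0 := septic_ne_zero χ 0
  rw [septic_zero_right] at hne ⊢
  rw [rootMultiplicity_mul hne, rootMultiplicity_X_sub_C]
  have hne2 := right_ne_zero_of_mul hne
  rw [rootMultiplicity_mul hne2, h3, mul_pow, ← C_pow]
  rw [show (X : ℝ[X]) ^ 2 = (X - C 0) ^ 2 by simp]
  congr 2
  · classical
    rw [← count_roots, roots_pow, roots_X_sub_C]
    by_cases h : x = 0 <;> simp [h]
  · classical
    rw [← count_roots, roots_C_mul _ (by norm_num), roots_pow, roots_X_sub_C]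
    by_cases h : x = χ / 3 <;> simp [h]

/-! ### Rescaled form of the root equation

With `χ = c τ` and `u = (2 s + c) τ / 3`, the equation `P(u; χ, τ) = 0` takes the form
`108 s ^ 3 = τ ^ 2 * weight c s`. -/

/-- The denominator of the rational function `s ↦ 108 s ^ 3 / weight c s` whose level sets are the
real roots of the septic polynomial. -/
def weight (c s : ℝ) : ℝ := (c - s) * (2 * s + c) ^ 2 * (s ^ 2 + 1) ^ 2

/-- The polynomial whose zeros are the critical points of `s ↦ 108 s ^ 3 / weight c s`. -/
def criticalPoly (c s : ℝ) : ℝ := c ^ 2 * (3 - s ^ 2) - 4 * c * s ^ 3 + 8 * s ^ 4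

/-- The derivative of `weight c`. -/
def weightDeriv (c s : ℝ) : ℝ :=
  -((2 * s + c) ^ 2 * (s ^ 2 + 1) ^ 2) + (c - s) * (4 * (2 * s + c)) * (s ^ 2 + 1) ^ 2
    + (c - s) * (2 * s + c) ^ 2 * (4 * s * (s ^ 2 + 1))

theorem three_mul_weight_sub (c s : ℝ) : 3 * weight c s - s * weightDeriv c s =
    (2 * s + c) * (s ^ 2 + 1) * criticalPoly c s := by
  unfold weight weightDeriv criticalPoly
  ring

theorem hasDerivAt_weight (c s : ℝ) : HasDerivAt (weight c) (weightDeriv c s) s := by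
  have h1 : HasDerivAt (fun x : ℝ => c - x) (-1) s := (hasDerivAt_id s).const_sub c
  have h2 : HasDerivAt (fun x : ℝ => 2 * x + c) (2 * 1) s :=
    ((hasDerivAt_id s).const_mul 2).add_const c
  have h3 : HasDerivAt (fun x : ℝ => x ^ 2 + 1) (2 * s) s := by
    simpa using (hasDerivAt_pow 2 s).add_const 1
  refine ((h1.mul (h2.pow 2)).mul (h3.pow 2)).congr_deriv ?_
  simp only [weightDeriv, Pi.mul_apply, Pi.pow_apply]
  push_cast
  ring

theorem continuous_weight (c : ℝ) : Continuous (weight c) := by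
  unfold weight
  fun_prop

theorem weight_pos {c s : ℝ} (hs : 0 ≤ s) (hsc : s < c) : 0 < weight c s := by
  have h1 : 0 < c - s := sub_pos.2 hsc
  have h2 : 0 < 2 * s + c := by linarith
  unfold weight
  positivity

theorem criticalPoly_eq_zero {c s : ℝ} (hs : 0 < s) (hsc : s < c)
    (h : 3 * weight c s = s * weightDeriv c s) : criticalPoly c s = 0 := by
  have h1 := three_mul_weight_sub c s
  rw [h, sub_self] at h1
  have h2 : 0 < (2 * s + c) * (s ^ 2 + 1) := mul_pos (by linarith) (by positivity)
  exact (mul_eq_zero.1 h1.symm).resolve_left h2.ne'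

theorem eval_septic_rescaled (c τ s : ℝ) :
    27 * (septic (c * τ) τ).eval ((2 * s + c) * τ / 3) =
      32 * τ ^ 5 * (108 * s ^ 3 - τ ^ 2 * weight c s) := by
  rw [eval_septic]
  unfold weight
  ring

theorem eval_derivative_septic_rescaled (c τ s : ℝ) :
    9 * (derivative (septic (c * τ) τ)).eval ((2 * s + c) * τ / 3) =
      16 * τ ^ 4 * (324 * s ^ 2 - τ ^ 2 * weightDeriv c s) := by
  simp only [septic, derivative_add, derivative_sub, derivative_mul, derivative_X_pow,
    derivative_C, derivative_X, eval_add, eval_sub, eval_mul, eval_pow, eval_C, eval_X,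
    eval_zero, eval_one, Nat.cast_ofNat, Nat.reduceSub]
  unfold weightDeriv
  ring

theorem isRoot_septic_rescaled_iff {c τ s : ℝ} (hτ : 0 < τ) :
    (septic (c * τ) τ).IsRoot ((2 * s + c) * τ / 3) ↔ 108 * s ^ 3 = τ ^ 2 * weight c s := by
  have h := eval_septic_rescaled c τ s
  have h5 : 32 * τ ^ 5 ≠ 0 := by positivity
  constructor
  · intro h0
    rw [IsRoot.def.1 h0, mul_zero] at h
    exact sub_eq_zero.1 ((mul_eq_zero.1 h.symm).resolve_left h5)
  · intro h0
    rw [h0, sub_self, mul_zero] at h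
    exact (mul_eq_zero.1 h).resolve_left (by norm_num)

theorem root_mem_Ioo {c τ s : ℝ} (hc : 0 < c) (hτ : 0 < τ)
    (h : 108 * s ^ 3 = τ ^ 2 * weight c s) : 0 < s ∧ s < c := by
  have hs : 0 < s := by
    by_contra hs
    rw [not_lt] at hs
    rcases hs.eq_or_lt with rfl | hs
    · have : 0 < τ ^ 2 * weight c 0 := mul_pos (by positivity) (weight_pos le_rfl hc)
      norm_num at h
      rcases h with h | h <;> simp [h] at this
    · have h1 : s ^ 3 < 0 := Odd.pow_neg (by decide) hs
      have h2 : 0 < c - s := by linarith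
      have : 0 ≤ τ ^ 2 * weight c s := by unfold weight; positivity
      linarith
  refine ⟨hs, ?_⟩
  by_contra hsc
  rw [not_lt] at hsc
  have h1 : 0 < s ^ 3 := by positivity
  have h2 : τ ^ 2 * weight c s ≤ 0 := by
    have : weight c s = -((s - c) * ((2 * s + c) ^ 2 * (s ^ 2 + 1) ^ 2)) := by
      unfold weight; ring
    rw [this, mul_neg, neg_nonpos]
    have := sub_nonneg.2 hsc
    positivity
  linarith

/-! ### Critical values lie in the region enclosed by the boundary curve -/

theorem collision_cofactor_pos {k : ℝ} (h0 : 0 < k) (h1 : k < 7 / 10) :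
    0 < 16 + 63 * k + 264 * k ^ 2 + 1340 * k ^ 3 - 336 * k ^ 4 + 1008 * k ^ 5 - 9600 * k ^ 6
      + 9792 * k ^ 7 - 6912 * k ^ 8 + 4608 * k ^ 9 := by
  have a1 : 0 ≤ k ^ 7 * (4608 * (k - 3 / 4) ^ 2) := by positivity
  have a2 : 0 ≤ k ^ 5 * (7200 * (k - 2 / 3) ^ 2) := by positivity
  have a3 : 0 ≤ k ^ 3 * (2192 * ((7 / 10 - k) * (7 / 10 + k))) := by
    have : 0 ≤ 7 / 10 - k := by linarith
    positivity
  have a4 : 0 ≤ k ^ 3 * (336 * (7 / 10 - k)) := by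
    have : 0 ≤ 7 / 10 - k := by linarith
    positivity
  have a5 : 0 < k ^ 3 := by positivity
  have a6 : 0 < k ^ 2 := by positivity
  nlinarith

theorem collision_gap {x g k : ℝ} (hk : 0 < k) (hk1 : k < 1)
    (hx : x * (k ^ 2 * (1 + 4 * k - 8 * k ^ 2)) = 3)
    (hq : 0 < 1 + 4 * k - 8 * k ^ 2)
    (hg : g * (4 * (1 - k) ^ 3 * (1 + 2 * k) ^ 4) = 27 * k ^ 3 * (1 + 4 * k - 8 * k ^ 2) ^ 2) :
    ((x + 4) ^ 2 * g + 108) ^ 2 ≤ 4 * x * (x + 36) ^ 2 * g ∧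
      (((x + 4) ^ 2 * g + 108) ^ 2 = 4 * x * (x + 36) ^ 2 * g → k = 1 / 2) := by
  have hk7 : k < 7 / 10 := by nlinarith
  have hcof := collision_cofactor_pos hk hk7
  set cof := 16 + 63 * k + 264 * k ^ 2 + 1340 * k ^ 3 - 336 * k ^ 4 + 1008 * k ^ 5 - 9600 * k ^ 6
      + 9792 * k ^ 7 - 6912 * k ^ 8 + 4608 * k ^ 9 with hcofdef
  have h1k : 0 < 1 - k := by linarith
  set q := 1 + 4 * k - 8 * k ^ 2 with hqdef
  have hx' : x = 3 / (k ^ 2 * q) := by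
    rw [eq_div_iff (by positivity)]; exact hx
  have hg' : g = 27 * k ^ 3 * q ^ 2 / (4 * (1 - k) ^ 3 * (1 + 2 * k) ^ 4) := by
    rw [eq_div_iff (by positivity)]; exact hg
  have key : 4 * x * (x + 36) ^ 2 * g - ((x + 4) ^ 2 * g + 108) ^ 2 =
      729 * ((1 - 2 * k) ^ 6 * (1 + 2 * k) ^ 4 * cof) /
        (16 * k ^ 3 * q * ((1 - k) ^ 3 * (1 + 2 * k) ^ 4) ^ 2) := by
    rw [hx', hg']
    have hq0 : q ≠ 0 := hq.ne'
    have h1k0 : 1 - k ≠ 0 := h1k.ne'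
    field_simp
    rw [hcofdef, hqdef]
    ring
  have h6 : 0 ≤ (1 - 2 * k) ^ 6 := Even.pow_nonneg (by decide) _
  constructor
  · rw [← sub_nonneg, key]
    positivity
  · intro h
    rw [h, sub_self, eq_comm, div_eq_zero_iff] at key
    have hd : 16 * k ^ 3 * q * ((1 - k) ^ 3 * (1 + 2 * k) ^ 4) ^ 2 ≠ 0 := by positivity
    have hn := key.resolve_right hd
    have hp : 0 < 729 * ((1 + 2 * k) ^ 4 * cof) := by positivity
    have : (1 - 2 * k) ^ 6 = 0 := by
      have h0 : (1 - 2 * k) ^ 6 * (729 * ((1 + 2 * k) ^ 4 * cof)) = 0 := by linarith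
      exact (mul_eq_zero.1 h0).resolve_right hp.ne'
    have := pow_eq_zero_iff (by norm_num) |>.1 this
    linarith

/-- The value of `boundaryPoly (c * τ) τ / τ ^ 2`. -/
def scaledBoundary (c τ : ℝ) : ℝ :=
  (c ^ 2 + 4) ^ 2 * τ ^ 2 - 2 * c * (c ^ 2 + 36) * τ + 108

theorem boundaryPoly_rescaled (c τ : ℝ) :
    boundaryPoly (c * τ) τ = τ ^ 2 * scaledBoundary c τ := by
  unfold boundaryPoly scaledBoundary
  ring

theorem scaledBoundary_critical {c τ s : ℝ} (hτ : 0 < τ) (hs : 0 < s) (hsc : s < c)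
    (hcrit : criticalPoly c s = 0) (h : 108 * s ^ 3 = τ ^ 2 * weight c s) :
    scaledBoundary c τ ≤ 0 ∧
      (scaledBoundary c τ = 0 → c = 2 * Real.sqrt 3 ∧ τ = 3 * Real.sqrt 3 / 8) := by
  have hc : 0 < c := hs.trans hsc
  obtain ⟨k, rfl⟩ : ∃ k, s = k * c := ⟨s / c, by field_simp⟩
  have hk : 0 < k := pos_of_mul_pos_left hs hc.le
  have hk1 : k < 1 := by nlinarith
  have hx : c ^ 2 * (k ^ 2 * (1 + 4 * k - 8 * k ^ 2)) = 3 := by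
    have h0 : c ^ 2 * (3 - c ^ 2 * (k ^ 2 * (1 + 4 * k - 8 * k ^ 2))) = 0 := by
      rw [← hcrit]; unfold criticalPoly; ring
    have := (mul_eq_zero.1 h0).resolve_left (by positivity)
    linarith
  have hq : 0 < 1 + 4 * k - 8 * k ^ 2 := by
    by_contra hq
    have : c ^ 2 * (k ^ 2 * (1 + 4 * k - 8 * k ^ 2)) ≤ 0 :=
      mul_nonpos_of_nonneg_of_nonpos (by positivity)
        (mul_nonpos_of_nonneg_of_nonpos (by positivity) (not_lt.1 hq))
    linarith
  have hg : τ ^ 2 * (4 * (1 - k) ^ 3 * (1 + 2 * k) ^ 4) =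
      27 * k ^ 3 * (1 + 4 * k - 8 * k ^ 2) ^ 2 := by
    have h1 : 108 * k ^ 3 = τ ^ 2 * ((1 - k) * (1 + 2 * k) ^ 2 * (k ^ 2 * c ^ 2 + 1) ^ 2) := by
      have h0 : c ^ 3 * (108 * k ^ 3) =
          c ^ 3 * (τ ^ 2 * ((1 - k) * (1 + 2 * k) ^ 2 * (k ^ 2 * c ^ 2 + 1) ^ 2)) := by
        unfold weight at h
        linear_combination h
      exact mul_left_cancel₀ (by positivity) h0
    have h2 : (k ^ 2 * c ^ 2 + 1) * (1 + 4 * k - 8 * k ^ 2) = 4 * (1 - k) * (1 + 2 * k) := by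
      linear_combination hx
    have h3 : ((k ^ 2 * c ^ 2 + 1) * (1 + 4 * k - 8 * k ^ 2)) ^ 2 =
      (4 * (1 - k) * (1 + 2 * k)) ^ 2 := by rw [h2]
    linear_combination (-(1 + 4 * k - 8 * k ^ 2) ^ 2 / 4) * h1
      - (τ ^ 2 * (1 - k) * (1 + 2 * k) ^ 2 / 4) * h3
  obtain ⟨hle, heq⟩ := collision_gap hk hk1 hx hq hg
  have hr : 4 * c ^ 2 * (c ^ 2 + 36) ^ 2 * τ ^ 2 = (2 * c * (c ^ 2 + 36) * τ) ^ 2 := by ring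
  rw [hr] at hle heq
  have hr0 : 0 ≤ 2 * c * (c ^ 2 + 36) * τ := by positivity
  constructor
  · have := (pow_le_pow_iff_left₀ (by positivity) hr0 two_ne_zero).1 hle
    unfold scaledBoundary
    linarith
  · intro h0
    have hk2 : k = 1 / 2 := heq (by
      congr 1
      unfold scaledBoundary at h0
      linarith)
    subst hk2
    have h3 : Real.sqrt 3 ^ 2 = 3 := Real.sq_sqrt (by norm_num)
    have h30 : 0 < Real.sqrt 3 := by positivity
    constructor
    · refine (pow_left_inj₀ hc.le (by positivity) two_ne_zero).1 ?_
      rw [mul_pow, h3]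
      linarith
    · refine (pow_left_inj₀ hτ.le (by positivity) two_ne_zero).1 ?_
      rw [div_pow, mul_pow, h3]
      linarith

theorem critical_value_comparison {c τ : ℝ} (hτ : 0 < τ) (hF : 0 ≤ scaledBoundary c τ)
    (hcusp : ¬ (c = 2 * Real.sqrt 3 ∧ τ = 3 * Real.sqrt 3 / 8)) :
    (∀ s, 0 < s → s < c → criticalPoly c s = 0 → 108 * s ^ 3 < τ ^ 2 * weight c s) ∨
      (∀ s, 0 < s → s < c → criticalPoly c s = 0 → τ ^ 2 * weight c s < 108 * s ^ 3) := by
  have main : ∀ s, 0 < s → s < c → criticalPoly c s = 0 → ∃ t, 0 < t ∧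
      108 * s ^ 3 = t ^ 2 * weight c s ∧ scaledBoundary c t ≤ 0 ∧ t ≠ τ := by
    intro s hs hsc hcrit
    have hw := weight_pos hs.le hsc
    have hr : 0 < 108 * s ^ 3 / weight c s := by positivity
    have ht : 108 * s ^ 3 = Real.sqrt (108 * s ^ 3 / weight c s) ^ 2 * weight c s := by
      rw [Real.sq_sqrt hr.le]; field_simp
    obtain ⟨h1, h2⟩ := scaledBoundary_critical (Real.sqrt_pos.2 hr) hs hsc hcrit ht
    refine ⟨_, Real.sqrt_pos.2 hr, ht, h1, ?_⟩
    intro h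
    rw [h] at h1 h2
    exact hcusp (h2 (le_antisymm h1 hF))
  have hdiff (t : ℝ) : scaledBoundary c t - scaledBoundary c τ =
      (t - τ) * ((c ^ 2 + 4) ^ 2 * (t + τ) - 2 * c * (c ^ 2 + 36)) := by
    unfold scaledBoundary; ring
  rcases le_total (c * (c ^ 2 + 36)) ((c ^ 2 + 4) ^ 2 * τ) with hv | hv
  · left
    intro s hs hsc hcrit
    obtain ⟨t, ht, hst, hFt, hne⟩ := main s hs hsc hcrit
    have hlt : t < τ := by
      by_contra h
      have h' : τ < t := lt_of_le_of_ne (not_lt.1 h) hne.symm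
      have : 0 < (t - τ) * ((c ^ 2 + 4) ^ 2 * (t + τ) - 2 * c * (c ^ 2 + 36)) := by
        refine mul_pos (sub_pos.2 h') ?_
        have : 0 < (c ^ 2 + 4) ^ 2 * (t - τ) := mul_pos (by positivity) (sub_pos.2 h')
        linarith
      linarith [hdiff t]
    rw [hst]
    have := weight_pos hs.le hsc
    gcongr
  · right
    intro s hs hsc hcrit
    obtain ⟨t, ht, hst, hFt, hne⟩ := main s hs hsc hcrit
    have hlt : τ < t := by
      by_contra h
      have h' : t < τ := lt_of_le_of_ne (not_lt.1 h) hne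
      have : 0 < (t - τ) * ((c ^ 2 + 4) ^ 2 * (t + τ) - 2 * c * (c ^ 2 + 36)) := by
        refine mul_pos_of_neg_of_neg (sub_neg.2 h') ?_
        have : 0 < (c ^ 2 + 4) ^ 2 * (τ - t) := mul_pos (by positivity) (sub_pos.2 h')
        linarith
      linarith [hdiff t]
    rw [hst]
    have := weight_pos hs.le hsc
    gcongr

/-! ### Uniqueness of the real root -/

theorem criticalPoly_of_isLocalMax_div {c s : ℝ} (hs : 0 < s) (hsc : s < c)
    (h : IsLocalMax (fun x => x ^ 3 / weight c x) s) : criticalPoly c s = 0 := by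
  have hw := weight_pos hs.le hsc
  have hd := h.hasDerivAt_eq_zero ((hasDerivAt_pow 3 s).div (hasDerivAt_weight c s) hw.ne')
  rw [div_eq_zero_iff] at hd
  have hd := hd.resolve_right (by positivity)
  apply criticalPoly_eq_zero hs hsc
  have h0 : s ^ 2 * (3 * weight c s - s * weightDeriv c s) = 0 := by
    push_cast at hd
    linear_combination hd
  exact sub_eq_zero.1 ((mul_eq_zero.1 h0).resolve_left (by positivity))

theorem criticalPoly_of_isLocalMax_inv {c s : ℝ} (hs : 0 < s) (hsc : s < c)
    (h : IsLocalMax (fun x => weight c x / x ^ 3) s) : criticalPoly c s = 0 := by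
  have hd := h.hasDerivAt_eq_zero
    ((hasDerivAt_weight c s).div (hasDerivAt_pow 3 s) (by positivity))
  rw [div_eq_zero_iff] at hd
  have hd := hd.resolve_right (by positivity)
  apply criticalPoly_eq_zero hs hsc
  have h0 : s ^ 2 * (3 * weight c s - s * weightDeriv c s) = 0 := by
    push_cast at hd
    linear_combination -hd
  exact sub_eq_zero.1 ((mul_eq_zero.1 h0).resolve_left (by positivity))

/-- A continuous function on `[l, b]` with `f l < y` cannot take the value `y` at both `a` and `b`,
where `l < a < b`, when every local maximum in `(l, b)` has value less than `y`. -/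
theorem no_repeated_value_of_localMax_lt {f : ℝ → ℝ} {l a b y : ℝ} (hla : l < a) (hab : a < b)
    (hf : ContinuousOn f (Set.Icc l b)) (hl : f l < y) (ha : f a = y) (hb : f b = y)
    (hmax : ∀ x ∈ Set.Ioo l b, IsLocalMax f x → f x < y) : False := by
  obtain ⟨x, hx, hxmax⟩ := isCompact_Icc.exists_isMaxOn ⟨a, hla.le, hab.le⟩ hf
  have hax : y ≤ f x := ha ▸ hxmax ⟨hla.le, hab.le⟩
  have hxl : l < x := lt_of_le_of_ne hx.1 (by rintro rfl; linarith)
  rcases hx.2.lt_or_eq with hxb | rfl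
  · exact absurd (hmax x ⟨hxl, hxb⟩ (hxmax.isLocalMax (Icc_mem_nhds hxl hxb))) (not_lt.2 hax)
  · have hamax : IsMaxOn f (Set.Icc l x) a := fun z hz => by
      have : f z ≤ f x := hxmax hz
      simpa [ha, hb] using this
    exact absurd (hmax a ⟨hla, hab⟩ (hamax.isLocalMax (Icc_mem_nhds hla hab))) (by simp [ha])

theorem not_two_roots {c τ a b : ℝ} (hτ : 0 < τ) (hF : 0 ≤ scaledBoundary c τ)
    (hcusp : ¬ (c = 2 * Real.sqrt 3 ∧ τ = 3 * Real.sqrt 3 / 8))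
    (ha0 : 0 < a) (hab : a < b) (hbc : b < c)
    (ha : 108 * a ^ 3 = τ ^ 2 * weight c a) (hb : 108 * b ^ 3 = τ ^ 2 * weight c b) : False := by
  have hb0 := ha0.trans hab
  have hac := hab.trans hbc
  rcases critical_value_comparison hτ hF hcusp with h | h
  · refine no_repeated_value_of_localMax_lt (f := fun x => x ^ 3 / weight c x) (l := 0)
      (y := τ ^ 2 / 108) ha0 hab ?_ ?_ ?_ ?_ ?_
    · exact (continuous_pow 3).continuousOn.div (continuous_weight c).continuousOn
        fun x hx => (weight_pos hx.1 (hx.2.trans_lt hbc)).ne'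
    · simp only [ne_eq, OfNat.ofNat_ne_zero, not_false_eq_true, zero_pow, zero_div]
      positivity
    · have := weight_pos ha0.le hac
      rw [div_eq_div_iff this.ne' (by norm_num)]; linarith
    · have := weight_pos hb0.le hbc
      rw [div_eq_div_iff this.ne' (by norm_num)]; linarith
    · intro x hx hmax
      have hxc := hx.2.trans hbc
      have := h x hx.1 hxc (criticalPoly_of_isLocalMax_div hx.1 hxc hmax)
      rw [div_lt_div_iff₀ (weight_pos hx.1.le hxc) (by norm_num)]
      linarith
  · refine no_repeated_value_of_localMax_lt (f := fun x => weight c (-x) / (-x) ^ 3) (l := -c)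
      (a := -b) (b := -a) (y := 108 / τ ^ 2) (by linarith) (by linarith) ?_ ?_ ?_ ?_ ?_
    · refine ContinuousOn.div ((continuous_weight c).comp continuous_neg).continuousOn
        (by fun_prop) fun x hx => ?_
      have : 0 < -x := by linarith [hx.2]
      positivity
    · have : weight c c = 0 := by unfold weight; ring
      simp only [neg_neg, this, zero_div]
      positivity
    · simp only [neg_neg]
      rw [div_eq_div_iff (by positivity) (by positivity)]; linarith
    · simp only [neg_neg]
      rw [div_eq_div_iff (by positivity) (by positivity)]; linarith
    · intro x hx hmax
      have hx0 : 0 < -x := by linarith [hx.2]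
      have hxc : -x < c := by linarith [hx.1]
      have hmax' : IsLocalMax (fun x => weight c x / x ^ 3) (-x) := by
        have hcomp : IsLocalMax ((fun x => weight c (-x) / (-x) ^ 3) ∘ Neg.neg) (-x) :=
          IsMaxFilter.comp_tendsto (g := Neg.neg) (l := nhds x) (by rw [neg_neg]; exact hmax)
            (by simpa using (continuous_neg (G := ℝ)).tendsto (-x))
        simpa [Function.comp_def] using hcomp
      have := h (-x) hx0 hxc (criticalPoly_of_isLocalMax_inv hx0 hxc hmax')
      rw [div_lt_div_iff₀ (by positivity) (by positivity)]
      linarith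

theorem cusp_root {s : ℝ} (hs : 0 < s)
    (h : 108 * s ^ 3 = (3 * Real.sqrt 3 / 8) ^ 2 * weight (2 * Real.sqrt 3) s) :
    s = Real.sqrt 3 := by
  have h3 : Real.sqrt 3 ^ 2 = 3 := Real.sq_sqrt (by norm_num)
  have h30 : 0 < Real.sqrt 3 := by positivity
  obtain ⟨y, rfl⟩ : ∃ y, s = y * Real.sqrt 3 := ⟨s / Real.sqrt 3, by field_simp⟩
  have hy : 0 < y := pos_of_mul_pos_left hs h30.le
  have h1 : Real.sqrt 3 * ((y - 1) ^ 3 * (9 * y ^ 4 + 27 * y ^ 3 + 33 * y ^ 2 + 9 * y + 2)) = 0 := by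
    have e : weight (2 * Real.sqrt 3) (y * Real.sqrt 3) =
        Real.sqrt 3 * (2 - y) * (Real.sqrt 3 ^ 2 * (2 * y + 2) ^ 2)
          * (y ^ 2 * Real.sqrt 3 ^ 2 + 1) ^ 2 := by
      unfold weight; ring
    have e3 : (y * Real.sqrt 3) ^ 3 = 3 * (y ^ 3 * Real.sqrt 3) := by
      linear_combination (y ^ 3 * Real.sqrt 3) * h3
    rw [e, e3, div_pow, mul_pow, h3] at h
    linear_combination (16 / 81) * h
  have h2 := (mul_eq_zero.1 h1).resolve_left h30.ne'
  have h4 := (mul_eq_zero.1 h2).resolve_right (by positivity)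
  have h5 : y - 1 = 0 := pow_eq_zero_iff (by norm_num) |>.1 h4
  rw [show y = 1 by linarith, one_mul]

theorem rescaled_root_unique {c τ a b : ℝ} (hc : 0 < c) (hτ : 0 < τ)
    (hF : 0 ≤ scaledBoundary c τ)
    (ha : 108 * a ^ 3 = τ ^ 2 * weight c a) (hb : 108 * b ^ 3 = τ ^ 2 * weight c b) : a = b := by
  obtain ⟨ha0, hac⟩ := root_mem_Ioo hc hτ ha
  obtain ⟨hb0, hbc⟩ := root_mem_Ioo hc hτ hb
  by_cases hcusp : c = 2 * Real.sqrt 3 ∧ τ = 3 * Real.sqrt 3 / 8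
  · obtain ⟨rfl, rfl⟩ := hcusp
    rw [cusp_root ha0 ha, cusp_root hb0 hb]
  · rcases lt_trichotomy a b with h | h | h
    · exact (not_two_roots hτ hF hcusp ha0 h hbc ha hb).elim
    · exact h
    · exact (not_two_roots hτ hF hcusp hb0 h hac hb ha).elim

theorem septic_root_unique {χ τ x y : ℝ} (hχ : 0 < χ) (hτ : 0 < τ) (hF : 0 ≤ boundaryPoly χ τ)
    (hx : (septic χ τ).IsRoot x) (hy : (septic χ τ).IsRoot y) : x = y := by
  obtain ⟨c, rfl⟩ : ∃ c, χ = c * τ := ⟨χ / τ, by field_simp⟩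
  have hc : 0 < c := pos_of_mul_pos_left hχ hτ.le
  have hsur (z : ℝ) : ∃ s, z = (2 * s + c) * τ / 3 := ⟨(3 * z / τ - c) / 2, by field_simp; ring⟩
  obtain ⟨a, rfl⟩ := hsur x
  obtain ⟨b, rfl⟩ := hsur y
  rw [boundaryPoly_rescaled] at hF
  rw [isRoot_septic_rescaled_iff hτ] at hx hy
  rw [rescaled_root_unique hc hτ (nonneg_of_mul_nonneg_right hF (by positivity)) hx hy]

theorem septic_root_simple {χ τ x : ℝ} (hχ : 0 < χ) (hτ : 0 < τ) (hF : 0 ≤ boundaryPoly χ τ)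
    (hcorner : (χ, τ) ≠ cornerPoint) (hx : (septic χ τ).IsRoot x) :
    (septic χ τ).rootMultiplicity x = 1 := by
  have hpos : 0 < (septic χ τ).rootMultiplicity x :=
    (rootMultiplicity_pos (septic_ne_zero χ τ)).2 hx
  by_contra hne
  have hroots := (one_lt_rootMultiplicity_iff_isRoot (septic_ne_zero χ τ)).1
    (by omega : 1 < (septic χ τ).rootMultiplicity x)
  obtain ⟨c, rfl⟩ : ∃ c, χ = c * τ := ⟨χ / τ, by field_simp⟩
  have hc : 0 < c := pos_of_mul_pos_left hχ hτ.le
  obtain ⟨s, rfl⟩ : ∃ s, x = (2 * s + c) * τ / 3 := ⟨(3 * x / τ - c) / 2, by field_simp; ring⟩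
  have h1 := (isRoot_septic_rescaled_iff hτ).1 hx
  have h2 : 324 * s ^ 2 = τ ^ 2 * weightDeriv c s := by
    have h := eval_derivative_septic_rescaled c τ s
    have h0 : (derivative (septic (c * τ) τ)).eval ((2 * s + c) * τ / 3) = 0 := by
      simpa using hroots.2
    rw [h0, mul_zero] at h
    exact sub_eq_zero.1 ((mul_eq_zero.1 h.symm).resolve_left (by positivity))
  obtain ⟨hs, hsc⟩ := root_mem_Ioo hc hτ h1
  have hcrit : criticalPoly c s = 0 := by
    apply criticalPoly_eq_zero hs hsc
    have : τ ^ 2 * (3 * weight c s) = τ ^ 2 * (s * weightDeriv c s) := by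
      linear_combination -3 * h1 + s * h2
    exact mul_left_cancel₀ (by positivity) this
  obtain ⟨hle, heq⟩ := scaledBoundary_critical hτ hs hsc hcrit h1
  rw [boundaryPoly_rescaled] at hF
  obtain ⟨rfl, rfl⟩ := heq (le_antisymm hle (nonneg_of_mul_nonneg_right hF (by positivity)))
  apply hcorner
  have h3 : Real.sqrt 3 * Real.sqrt 3 = 3 := Real.mul_self_sqrt (by norm_num)
  unfold cornerPoint
  ext
  · simp only
    linear_combination (3 / 4) * h3
  · rfl

theorem septic_eval_neg {χ τ : ℝ} (hχ : 0 < χ) (hτ : 0 < τ) :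
    (septic χ τ).eval (χ / 3) < 0 := by
  have h := eval_septic χ τ (χ / 3)
  have : 0 < 32 * χ ^ 3 * τ ^ 4 := by positivity
  linarith

theorem septic_eval_pos {χ τ : ℝ} (hχ : 0 < χ) (hτ : 0 < τ) : 0 < (septic χ τ).eval χ := by
  have h := eval_septic χ τ χ
  have : 0 < 432 * τ ^ 2 * (2 * χ) ^ 3 := by positivity
  linarith

theorem exists_septic_root {χ τ : ℝ} (hχ : 0 < χ) (hτ : 0 < τ) :
    ∃ x, (septic χ τ).IsRoot x :=
  mem_range_of_exists_le_of_exists_ge (septic χ τ).continuous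
    ⟨_, (septic_eval_neg hχ hτ).le⟩ ⟨_, (septic_eval_pos hχ hτ).le⟩

theorem isRoot_septic_zero_left {τ x : ℝ} (hτ : 0 < τ) (hx : (septic 0 τ).IsRoot x) : x = 0 := by
  have h := eval_septic 0 τ x
  rw [IsRoot.def.1 hx, mul_zero] at h
  have h0 : x ^ 3 * (27 * ((3 * x) ^ 2 + 4 * τ ^ 2) ^ 2 + 11664 * τ ^ 2) = 0 := by
    linear_combination -h
  have := (mul_eq_zero.1 h0).resolve_right (by positivity)
  exact pow_eq_zero_iff (by norm_num) |>.1 this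

theorem odd_rootMultiplicity_septic_zero_left {τ : ℝ} (hτ : 0 < τ) :
    Odd ((septic 0 τ).rootMultiplicity 0) := by
  refine odd_rootMultiplicity_of_unique_root (x₀ := -1) (x₁ := 1)
    (fun x hx => isRoot_septic_zero_left hτ hx) ?_ ?_
  · have h := eval_septic 0 τ (-1)
    nlinarith [sq_nonneg τ, sq_nonneg ((3 * (-1) - 0) ^ 2 + 4 * τ ^ 2)]
  · have h := eval_septic 0 τ 1
    nlinarith [sq_nonneg τ, sq_nonneg ((3 * 1 - 0) ^ 2 + 4 * τ ^ 2)]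

theorem odd_rootMultiplicity_septic_zero_right_iff (χ x : ℝ) :
    Odd ((septic χ 0).rootMultiplicity x) ↔ x = χ := by
  rw [rootMultiplicity_septic_zero_right]
  split_ifs <;> simp_all <;> decide

open Classical in
/-- The distinguished real root of the septic polynomial. -/
noncomputable def oddRoot (p : ℝ × ℝ) : ℝ :=
  if h : 0 < p.1 ∧ 0 < p.2 then (exists_septic_root h.1 h.2).choose
  else if p.2 = 0 then p.1 else 0

theorem isRoot_oddRoot {χ τ : ℝ} (hχ : 0 < χ) (hτ : 0 < τ) :
    (septic χ τ).IsRoot (oddRoot (χ, τ)) := by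
  have h : 0 < (χ, τ).1 ∧ 0 < (χ, τ).2 := ⟨hχ, hτ⟩
  rw [oddRoot, dif_pos h]
  exact (exists_septic_root hχ hτ).choose_spec

theorem oddRoot_zero_right (χ : ℝ) : oddRoot (χ, 0) = χ := by simp [oddRoot]

theorem oddRoot_zero_left (τ : ℝ) : oddRoot (0, τ) = 0 := by simp [oddRoot]

theorem odd_rootMultiplicity_septic_iff {χ τ : ℝ} (hχ : 0 ≤ χ) (hτ : 0 ≤ τ)
    (hF : 0 ≤ boundaryPoly χ τ) (x : ℝ) :
    Odd ((septic χ τ).rootMultiplicity x) ↔ x = oddRoot (χ, τ) := by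
  rcases hτ.eq_or_lt with rfl | hτ
  · rw [oddRoot_zero_right, odd_rootMultiplicity_septic_zero_right_iff]
  have hroot (h : Odd ((septic χ τ).rootMultiplicity x)) : (septic χ τ).IsRoot x :=
    (rootMultiplicity_pos (septic_ne_zero χ τ)).1 h.pos
  rcases hχ.eq_or_lt with rfl | hχ
  · rw [oddRoot_zero_left]
    refine ⟨fun h => isRoot_septic_zero_left hτ (hroot h), ?_⟩
    rintro rfl
    exact odd_rootMultiplicity_septic_zero_left hτ
  · have huniq : ∀ y, (septic χ τ).IsRoot y → y = oddRoot (χ, τ) := fun y hy =>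
      septic_root_unique hχ hτ hF hy (isRoot_oddRoot hχ hτ)
    have hodd := odd_rootMultiplicity_of_unique_root huniq
      (septic_eval_neg hχ hτ) (septic_eval_pos hχ hτ)
    refine ⟨fun h => huniq x (hroot h), ?_⟩
    rintro rfl
    exact hodd

end RogueWave

theorem proposition2 :
    ∃ u : ℝ × ℝ → ℝ,
      -- `u (χ, τ)` is the unique real root of odd multiplicity
      (∀ p ∈ closure (RogueWave.regionE ∪ RogueWave.regionS), ∀ x : ℝ,
        Odd ((RogueWave.septic p.1 p.2).rootMultiplicity x) ↔ x = u p) ∧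
      (∀ τ : ℝ, 0 < τ → u (0, τ) = 0) ∧
      (∀ χ : ℝ, 2 < χ → u (χ, 0) = χ) ∧
      -- uniqueness among all real roots, and simplicity
      ∃ τ₁ : ℝ, 0 < τ₁ ∧ ∃ exceptional : Finset ℝ,
        exceptional.card ≤ 3 ∧ (∀ χ ∈ exceptional, 0 < χ) ∧
        ∀ χ τ : ℝ, (χ, τ) ∈ closure (RogueWave.regionE ∪ RogueWave.regionS) →
          χ ≠ 0 → ¬ (τ = τ₁ ∧ χ ∈ exceptional) →
          (τ ≠ 0 → ∀ x : ℝ, (RogueWave.septic χ τ).IsRoot x → x = u (χ, τ)) ∧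
          ((χ, τ) ≠ RogueWave.cornerPoint →
            (RogueWave.septic χ τ).rootMultiplicity (u (χ, τ)) = 1) := by
  refine ⟨RogueWave.oddRoot, ?_, fun τ _ => RogueWave.oddRoot_zero_left τ,
    fun χ _ => RogueWave.oddRoot_zero_right χ, 1, one_pos, ∅, by simp, by simp, ?_⟩
  · intro p hp x
    obtain ⟨h1, h2, h3⟩ := RogueWave.quadrant_and_boundaryPoly_nonneg hp
    exact RogueWave.odd_rootMultiplicity_septic_iff h1 h2 h3 x
  · intro χ τ hp hχ _
    obtain ⟨h1, h2, h3⟩ := RogueWave.quadrant_and_boundaryPoly_nonneg hp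
    have hχ' : 0 < χ := lt_of_le_of_ne h1 hχ.symm
    refine ⟨fun hτ x hx => ?_, fun hcorner => ?_⟩
    · have hτ' : 0 < τ := lt_of_le_of_ne h2 hτ.symm
      exact RogueWave.septic_root_unique hχ' hτ' h3 hx (RogueWave.isRoot_oddRoot hχ' hτ')
    · rcases h2.eq_or_lt with rfl | hτ'
      · rw [RogueWave.oddRoot_zero_right, RogueWave.rootMultiplicity_septic_zero_right,
          if_pos rfl, if_neg hχ, if_neg]
        intro h
        apply hχ
        linarith
      · exact RogueWave.septic_root_simple hχ' hτ' h3 hcorner (RogueWave.isRoot_oddRoot hχ' hτ')
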